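/- Let $p,q,k$ be positive integers with $p$ and $q$ coprime and $p<q$. Put \[ D_{p,q,k}=\bigl\{\pm\bigl(q^{2k+j}-q^{2k-j},\,-pq^{j}-2q^{2k}\bigr) : j=0,1,\ldots,2k-1\bigr\}\subseteq\mathbb{Z}^2, \qquad C_{p,q,k}=\bigcup_{j=0}^{\infty}(qj+1)\,D_{p,q,k}, \] and let $G(\mathbb{Z}^2,C_{p,q,k})$ be the Cayley graph with vertex set $\mathbb{Z}^2$ in which $u$ and $v$ are adjacent if and only if $u-v\in C_{p,q,k}$ (note that $C_{p,q,k}=-C_{p,q,k}$ and $0\notin C_{p,q,k}$). For $I\subseteq\mathbb{Z}^2$ let \[ \delta(I)=\limsup_{R\to\infty}\frac{|I\cap[-R,R]^2|}{(2R)^2} \] be its upper density, and let $\overline{\alpha}(G(\mathbb{Z}^2,C_{p,q,k}))$ be the supremum of $\delta(I)$ over all independent sets $I$ of $G(\mathbb{Z}^2,C_{p,q,k})$. Then \[ \overline{\alpha}\bigl(G(\mathbb{Z}^2,C_{p,q,k})\bigr)\le\frac{1}{k+1}, \] and, as a consequence, the chromatic number satisfies $\chi\bigl(G(\mathbb{Z}^2,C_{p,q,k})\bigr)\ge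 k+1$. -/

import Mathlib

open Filter

/-- The set of lattice points of `[-R, R]^d`. -/
def latticeBox (d : ℕ) (R : ℝ) : Set (Fin d → ℤ) :=
  {x | ∀ i, (x i : ℝ) ∈ Set.Icc (-R) R}

/-- The upper density of `I ⊆ ℤ^d`: the upper limit, as the real number `R` tends to infinity, of
`|I ∩ [-R, R]^d| / (2R)^d`. It is taken in the extended reals, where every upper limit exists. -/
noncomputable def upperDensity {d : ℕ} (I : Set (Fin d → ℤ)) : EReal :=
  limsup (fun R : ℝ => (((I ∩ latticeBox d R).ncard / (2 * R) ^ d : ℝ) : EReal)) atTop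

/-- The supremum of the upper densities of the independent sets of a graph on `ℤ^d`. -/
noncomputable def independenceDensity {d : ℕ} (G : SimpleGraph (Fin d → ℤ)) : EReal :=
  ⨆ (I : Set (Fin d → ℤ)) (_ : G.IsIndepSet I), upperDensity I

/-- The vector `(q^(2k+j) - q^(2k-j), -p q^j - 2 q^(2k))` of `ℤ²`. Only `j < 2k` is used, so
that the subtraction of exponents is not truncated. -/
def genVector (p q k j : ℕ) : Fin 2 → ℤ :=
  ![(q : ℤ) ^ (2 * k + j) - (q : ℤ) ^ (2 * k - j), -(p : ℤ) * (q : ℤ) ^ j - 2 * (q : ℤ) ^ (2 * k)]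

/-- `D_{p,q,k}`, the set of the vectors `± genVector p q k j` for `j = 0, …, 2k - 1`. -/
def setD (p q k : ℕ) : Set (Fin 2 → ℤ) :=
  {v | ∃ j < 2 * k, v = genVector p q k j ∨ v = -genVector p q k j}

/-- `C_{p,q,k}`, the union of the sets `(q j + 1) D_{p,q,k}` over all `j = 0, 1, 2, …`. -/
def setC (p q k : ℕ) : Set (Fin 2 → ℤ) :=
  ⋃ j : ℕ, {v | ∃ d ∈ setD p q k, v = ((q : ℤ) * (j : ℤ) + 1) • d}

theorem neg_mem_setC {p q k : ℕ} {v : Fin 2 → ℤ} (hv : v ∈ setC p q k) : -v ∈ setC p q k := by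
  simp only [setC, Set.mem_iUnion, Set.mem_setOf_eq] at hv ⊢
  obtain ⟨j, d, ⟨i, hi, hd⟩, rfl⟩ := hv
  refine ⟨j, -d, ⟨i, hi, ?_⟩, by simp⟩
  rcases hd with rfl | rfl <;> simp

theorem zero_notMem_setC {p q k : ℕ} (hq : 0 < q) : (0 : Fin 2 → ℤ) ∉ setC p q k := by
  simp only [setC, Set.mem_iUnion, Set.mem_setOf_eq]
  rintro ⟨j, d, ⟨i, hi, hd⟩, h⟩
  have h1 := congrFun h 1
  have hq' : (0 : ℤ) < q := by exact_mod_cast hq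
  have hs : (0 : ℤ) < (q : ℤ) * (j : ℤ) + 1 := by positivity
  have hg : (0 : ℤ) < (p : ℤ) * (q : ℤ) ^ i + 2 * (q : ℤ) ^ (2 * k) := by positivity
  have hp := mul_pos hs hg
  rcases hd with rfl | rfl <;> simp [genVector] at h1 <;> rcases h1 with h1 | h1 <;> linarith

/-- The Cayley graph `G(ℤ², C_{p,q,k})`. -/
def graphC (p q k : ℕ) : SimpleGraph (Fin 2 → ℤ) :=
  SimpleGraph.addCayley (setC p q k)

/-- As `C_{p,q,k}` is centrally symmetric and does not contain `0`, two points are adjacent exactly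
if their difference lies in it. -/
theorem graphC_adj {p q k : ℕ} (hq : 0 < q) (u v : Fin 2 → ℤ) :
    (graphC p q k).Adj u v ↔ u - v ∈ setC p q k := by
  rw [graphC, SimpleGraph.addCayley_adj']
  constructor
  · rintro ⟨-, g, hg, rfl | rfl⟩
    · simpa using neg_mem_setC hg
    · simpa using hg
  · intro h
    refine ⟨?_, u - v, h, Or.inr (by abel)⟩
    rintro rfl
    exact zero_notMem_setC hq (by simpa using h)

/-! An invariant mean `M` on `ℤ²` turns bounded functions into a Hilbert space on which `ℤ²` acts by
isometries `U`. Let `x` be the indicator of an independent set, of mean `δ`. For a generator `d`,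
independence makes `x` orthogonal to all `U ((q j + 1) d) x`. Averaging over `j` (mean ergodic
theorem) bounds the component of `x` fixed by `d` by its component `T_d x` fixed by `q d` but
orthogonal to the `d`-fixed vectors. Constants are fixed, so the first component has norm at least
`δ`, and hence `‖T_d x‖² ≥ δ²` for each of the `2k` generators.

In spectral terms, `T_d` selects the characters whose value at `d` is a `q`-th root of unity other
than `1`. By `genVector_mem_of_smul_mem`, no character is selected by three generators, so the `T_d`
cover the complement of the constants at most twice: `2k δ² ≤ 2 (δ - δ²)`, i.e. `δ ≤ 1/(k+1)`.

Limits of box averages along ultrafilters are invariant means, which transfers the bound to upper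
density. For the chromatic number, the means of the colour classes add up to `1`. -/

section HilbertSpace

open Topology

variable {Γ H : Type*} [AddCommGroup Γ] [NormedAddCommGroup H] [InnerProductSpace ℝ H]

/-! ### Sums of commuting projections with bounded overlap. -/

/-- If the projections `F i`, `i ∈ s`, have pairwise products that vanish at `x`, then
`∑ ‖F i x‖² ≤ ‖x‖²`. -/
theorem sum_norm_sq_le_of_pairwise_zero {ι : Type*} (s : Finset ι) (F : ι → H →L[ℝ] H)
    (hsymm : ∀ i x y, inner ℝ (F i x) y = inner ℝ x (F i y)) (hidem : ∀ i x, F i (F i x) = F i x)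
    (x : H) (hx : ∀ i ∈ s, ∀ j ∈ s, i ≠ j → F i (F j x) = 0) :
    ∑ i ∈ s, ‖F i x‖ ^ 2 ≤ ‖x‖ ^ 2 := by
  have hself (i : ι) : inner ℝ x (F i x) = ‖F i x‖ ^ 2 := by
    rw [← real_inner_self_eq_norm_sq, hsymm, hidem]
  have h1 : inner ℝ x (∑ i ∈ s, F i x) = ∑ i ∈ s, ‖F i x‖ ^ 2 := by
    rw [inner_sum]
    exact Finset.sum_congr rfl fun i _ => hself i
  have h2 : ‖∑ i ∈ s, F i x‖ ^ 2 = ∑ i ∈ s, ‖F i x‖ ^ 2 := by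
    rw [← real_inner_self_eq_norm_sq, sum_inner]
    refine Finset.sum_congr rfl fun i hi => ?_
    rw [inner_sum, Finset.sum_eq_single_of_mem i hi, real_inner_self_eq_norm_sq]
    intro j hj hji
    rw [hsymm, hx i hi j hj hji.symm, inner_zero_right]
  have h3 := norm_sub_sq_real x (∑ i ∈ s, F i x)
  rw [h1, h2] at h3
  nlinarith [sq_nonneg ‖x - ∑ i ∈ s, F i x‖]

/-- If all triple products of the commuting projections `F 0, …, F (n - 1)` vanish, then
`∑ ‖F i x‖² ≤ 2 ‖x‖²`. -/
theorem sum_norm_sq_le_of_triple_zero (n : ℕ) (F : ℕ → H →L[ℝ] H)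
    (hsymm : ∀ i x y, inner ℝ (F i x) y = inner ℝ x (F i y)) (hidem : ∀ i x, F i (F i x) = F i x)
    (hcomm : ∀ i j x, F i (F j x) = F j (F i x))
    (hzero : ∀ i j l, i < j → j < l → l < n → ∀ x, F i (F j (F l x)) = 0) (x : H) :
    ∑ i ∈ Finset.range n, ‖F i x‖ ^ 2 ≤ 2 * ‖x‖ ^ 2 := by
  induction n generalizing x with
  | zero => simp
  | succ n ih =>
    have hpyth (y z : H) (hyz : inner ℝ y z = 0) : ‖y + z‖ ^ 2 = ‖y‖ ^ 2 + ‖z‖ ^ 2 := by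
      rw [norm_add_sq_real, hyz]; ring
    set u := F n x with hu
    set v := x - F n x with hv
    have hFv : F n v = 0 := by rw [hv, map_sub, hidem, sub_self]
    have hFu : F n u = u := hidem n x
    -- `F i` commutes with `F n`, so it preserves both the range and the kernel of `F n`, which are
    -- orthogonal.
    have huv (i : ℕ) : inner ℝ (F i u) (F i v) = 0 := by
      rw [← hFu, hcomm i n, hsymm, hcomm n i, hFv, map_zero, inner_zero_right]
    have hx : ‖x‖ ^ 2 = ‖u‖ ^ 2 + ‖v‖ ^ 2 := by
      rw [← hpyth, hu, hv, add_sub_cancel]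
      rw [← hFu, hsymm, hFv, inner_zero_right]
    have hFx (i : ℕ) : ‖F i x‖ ^ 2 = ‖F i u‖ ^ 2 + ‖F i v‖ ^ 2 := by
      rw [← hpyth _ _ (huv i), ← map_add, hu, hv, add_sub_cancel]
    -- On the range of `F n`, a pair product is a triple product with last factor `F n`. So `u` is
    -- covered once by the earlier projections and once by `F n`, and `v` only by the earlier ones.
    have h1 : ∑ i ∈ Finset.range n, ‖F i u‖ ^ 2 ≤ ‖u‖ ^ 2 := by
      refine sum_norm_sq_le_of_pairwise_zero _ F hsymm hidem u fun i hi j hj hij => ?_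
      rw [Finset.mem_range] at hi hj
      rcases lt_or_gt_of_ne hij with h | h
      · exact hzero i j n h hj (Nat.lt_succ_self n) x
      · rw [hcomm]
        exact hzero j i n h hi (Nat.lt_succ_self n) x
    have h2 := ih (fun i j l hij hjl hl => hzero i j l hij hjl (hl.trans (Nat.lt_succ_self n))) v
    rw [Finset.sum_range_succ]
    simp only [hFx] at *
    rw [Finset.sum_add_distrib, hFu, hFv, hx, norm_zero]
    linarith

/-! ### Isometric representations and projections onto fixed vectors. -/

/-- A representation of an additive commutative group by isometries of a Hilbert space. -/
structure IsometricRep (Γ H : Type*) [AddCommGroup Γ] [NormedAddCommGroup H]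
    [InnerProductSpace ℝ H] where
  /-- The operator by which a group element acts. -/
  op : Γ → H →L[ℝ] H
  op_zero : ∀ x, op 0 x = x
  op_add : ∀ v w x, op (v + w) x = op v (op w x)
  norm_op : ∀ v x, ‖op v x‖ = ‖x‖

namespace IsometricRep

variable (U : IsometricRep Γ H)

theorem op_comm (v w : Γ) (x : H) : U.op v (U.op w x) = U.op w (U.op v x) := by
  rw [← U.op_add, add_comm, U.op_add]

theorem inner_op_op (v : Γ) (x y : H) : inner ℝ (U.op v x) (U.op v y) = inner ℝ x y := by
  rw [real_inner_eq_norm_add_mul_self_sub_norm_mul_self_sub_norm_mul_self_div_two,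
    real_inner_eq_norm_add_mul_self_sub_norm_mul_self_sub_norm_mul_self_div_two, ← map_add,
    U.norm_op, U.norm_op, U.norm_op]

theorem inner_op (v : Γ) (x y : H) : inner ℝ (U.op v x) y = inner ℝ x (U.op (-v) y) := by
  rw [← U.inner_op_op (-v), ← U.op_add, neg_add_cancel, U.op_zero]

/-- The group elements that fix the vector `x`. -/
def stab (x : H) : AddSubgroup Γ where
  carrier := {v | U.op v x = x}
  zero_mem' := U.op_zero x
  add_mem' {v w} hv hw := by
    simp only [Set.mem_ofPred_eq] at *
    rw [U.op_add, hw, hv]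
  neg_mem' {v} hv := by
    simp only [Set.mem_ofPred_eq] at *
    conv_lhs => rw [← hv, ← U.op_add, neg_add_cancel, U.op_zero]

theorem mem_stab {x : H} {v : Γ} : v ∈ U.stab x ↔ U.op v x = x := Iff.rfl

end IsometricRep

variable [CompleteSpace H]

/-- The orthogonal projection onto the space of vectors that are fixed by `T`. -/
noncomputable def fixedProj (T : H →L[ℝ] H) : H →L[ℝ] H :=
  (T.eqLocus (1 : H →L[ℝ] H)).starProjection

theorem apply_fixedProj (T : H →L[ℝ] H) (x : H) : T (fixedProj T x) = fixedProj T x :=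
  (T.eqLocus (1 : H →L[ℝ] H)).starProjection_apply_mem x

theorem fixedProj_of_apply_eq {T : H →L[ℝ] H} {x : H} (hx : T x = x) : fixedProj T x = x :=
  Submodule.starProjection_eq_self_iff.2 hx

theorem inner_fixedProj (T : H →L[ℝ] H) (x y : H) :
    inner ℝ (fixedProj T x) y = inner ℝ x (fixedProj T y) :=
  Submodule.inner_starProjection_left_eq_right _ x y

theorem inner_sub_fixedProj (T : H →L[ℝ] H) (x : H) {y : H} (hy : T y = y) :
    inner ℝ (x - fixedProj T x) y = 0 := by
  rw [inner_sub_left, inner_fixedProj, fixedProj_of_apply_eq hy, sub_self]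

theorem fixedProj_eq_of_inner {T : H →L[ℝ] H} {x y : H} (hy : T y = y)
    (h : ∀ z, T z = z → inner ℝ (x - y) z = 0) : fixedProj T x = y :=
  Submodule.eq_starProjection_of_mem_of_inner_eq_zero (K := T.eqLocus (1 : H →L[ℝ] H)) hy h

/-- If `S` commutes with `T` and has an adjoint that commutes with `T`, then `S` commutes with the
projection onto the fixed vectors of `T`. -/
theorem fixedProj_comm {S S' T : H →L[ℝ] H} (hadj : ∀ x y, inner ℝ (S x) y = inner ℝ x (S' y))
    (hS : ∀ x, T x = x → T (S x) = S x) (hS' : ∀ x, T x = x → T (S' x) = S' x) (x : H) :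
    fixedProj T (S x) = S (fixedProj T x) := by
  refine fixedProj_eq_of_inner (hS _ (apply_fixedProj T x)) fun z hz => ?_
  rw [← map_sub, hadj, inner_sub_fixedProj T x (hS' z hz)]

/-! ### Torsion projections and the ratio bound. -/

namespace IsometricRep

variable (U : IsometricRep Γ H)

theorem fixedProj_op (v w : Γ) (x : H) :
    fixedProj (U.op v) (U.op w x) = U.op w (fixedProj (U.op v) x) :=
  fixedProj_comm (U.inner_op w) (fun x hx => by rw [U.op_comm, hx])
    (fun x hx => by rw [U.op_comm, hx]) x

theorem fixedProj_fixedProj_comm (v w : Γ) (x : H) :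
    fixedProj (U.op v) (fixedProj (U.op w) x) = fixedProj (U.op w) (fixedProj (U.op v) x) :=
  have h (x : H) (hx : U.op v x = x) :
      U.op v (fixedProj (U.op w) x) = fixedProj (U.op w) x := by
    rw [← U.fixedProj_op, hx]
  fixedProj_comm (inner_fixedProj _) h h x

/-- The projection onto the vectors fixed by `n • d` and orthogonal to those fixed by `d`. -/
noncomputable def torsionProj (n : ℕ) (d : Γ) : H →L[ℝ] H :=
  fixedProj (U.op (n • d)) - fixedProj (U.op d)

theorem torsionProj_apply (n : ℕ) (d : Γ) (x : H) :
    U.torsionProj n d x = fixedProj (U.op (n • d)) x - fixedProj (U.op d) x := rfl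

theorem inner_torsionProj (n : ℕ) (d : Γ) (x y : H) :
    inner ℝ (U.torsionProj n d x) y = inner ℝ x (U.torsionProj n d y) := by
  simp only [torsionProj_apply, inner_sub_left, inner_sub_right, inner_fixedProj]

theorem torsionProj_op (n : ℕ) (d w : Γ) (x : H) :
    U.torsionProj n d (U.op w x) = U.op w (U.torsionProj n d x) := by
  simp only [torsionProj_apply, fixedProj_op, map_sub]

theorem torsionProj_comm (n : ℕ) (d e : Γ) (x : H) :
    U.torsionProj n d (U.torsionProj n e x) = U.torsionProj n e (U.torsionProj n d x) := by
  simp only [torsionProj_apply, map_sub]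
  rw [U.fixedProj_fixedProj_comm (n • d) (n • e), U.fixedProj_fixedProj_comm (n • d) e,
    U.fixedProj_fixedProj_comm d (n • e), U.fixedProj_fixedProj_comm d e]
  abel

theorem fixedProj_nsmul_fixedProj (n : ℕ) (d : Γ) (x : H) :
    fixedProj (U.op (n • d)) (fixedProj (U.op d) x) = fixedProj (U.op d) x :=
  fixedProj_of_apply_eq ((U.stab _).nsmul_mem (U.mem_stab.2 (apply_fixedProj (U.op d) x)) n)

/-- Vectors fixed by `d` are fixed by `n • d`, and a difference of projections onto nested subspaces
is a projection. -/
theorem torsionProj_idem (n : ℕ) (d : Γ) (x : H) :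
    U.torsionProj n d (U.torsionProj n d x) = U.torsionProj n d x := by
  have h := U.fixedProj_fixedProj_comm d (n • d) x
  rw [U.fixedProj_nsmul_fixedProj] at h
  simp only [torsionProj_apply, map_sub]
  rw [U.fixedProj_nsmul_fixedProj, h, fixedProj_of_apply_eq (apply_fixedProj (U.op d) x),
    fixedProj_of_apply_eq (apply_fixedProj (U.op (n • d)) x), sub_self, sub_zero]

theorem op_torsionProj (n : ℕ) (d : Γ) (x : H) :
    U.op (n • d) (U.torsionProj n d x) = U.torsionProj n d x := by
  have h : U.op (n • d) (fixedProj (U.op d) x) = fixedProj (U.op d) x :=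
    (U.stab _).nsmul_mem (U.mem_stab.2 (apply_fixedProj (U.op d) x)) n
  rw [torsionProj_apply, map_sub, apply_fixedProj, h]

theorem torsionProj_eq_zero_of_op_eq {n : ℕ} {d : Γ} {x : H} (hx : U.op d x = x) :
    U.torsionProj n d x = 0 := by
  have h : U.op (n • d) x = x := (U.stab _).nsmul_mem (U.mem_stab.2 hx) n
  rw [torsionProj_apply, fixedProj_of_apply_eq hx, fixedProj_of_apply_eq h, sub_self]

/-- The mean ergodic theorem along an arithmetic progression of multiples of `d`. -/
theorem inner_op_fixedProj_eq_zero {n : ℕ} {d : Γ} {x : H}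
    (hx : ∀ j : ℕ, inner ℝ x (U.op ((n * j + 1) • d) x) = 0) :
    inner ℝ x (U.op d (fixedProj (U.op (n • d)) x)) = 0 := by
  have hnorm : ‖U.op (n • d)‖ ≤ 1 :=
    ContinuousLinearMap.opNorm_le_bound _ zero_le_one fun y => by rw [U.norm_op, one_mul]
  have hlim := (U.op (n • d)).tendsto_birkhoffAverage_orthogonalProjection hnorm x
  have hiter (j : ℕ) : (U.op (n • d))^[j] x = U.op ((n * j) • d) x := by
    induction j with
    | zero => simp [U.op_zero]
    | succ j ih =>
      rw [Function.iterate_succ_apply', ih, ← U.op_add, ← add_nsmul, mul_add, mul_one, add_comm]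
  have hcont : Continuous fun y => inner ℝ x (U.op d y) := by fun_prop
  have hlim2 := (hcont.tendsto _).comp hlim
  -- Every Birkhoff average pairs to zero: its terms are the inner products in `hx`.
  refine tendsto_nhds_unique hlim2 (tendsto_const_nhds.congr fun N => ?_)
  simp only [Function.comp_apply, birkhoffAverage, birkhoffSum, id, hiter, map_smul, map_sum,
    inner_smul_right, inner_sum, ← U.op_add, ← succ_nsmul', hx]
  simp

/-- With `P` the projection onto the `d`-fixed vectors and `T` the torsion projection, the ergodic
identity reads `‖P x‖² + ⟨T x, U d (T x)⟩ = 0`; Cauchy–Schwarz bounds the second term by `‖T x‖²`.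
-/
theorem norm_fixedProj_le_norm_torsionProj {n : ℕ} {d : Γ} {x : H}
    (hx : ∀ j : ℕ, inner ℝ x (U.op ((n * j + 1) • d) x) = 0) :
    ‖fixedProj (U.op d) x‖ ^ 2 ≤ ‖U.torsionProj n d x‖ ^ 2 := by
  have h0 := U.inner_op_fixedProj_eq_zero hx
  have hsplit : fixedProj (U.op (n • d)) x = fixedProj (U.op d) x + U.torsionProj n d x := by
    rw [torsionProj_apply, add_sub_cancel]
  rw [hsplit, map_add, apply_fixedProj, inner_add_right] at h0
  have h1 : inner ℝ x (fixedProj (U.op d) x) = ‖fixedProj (U.op d) x‖ ^ 2 := by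
    rw [← real_inner_self_eq_norm_sq, inner_fixedProj,
      fixedProj_of_apply_eq (apply_fixedProj (U.op d) x)]
  have h2 : inner ℝ x (U.op d (U.torsionProj n d x)) =
      inner ℝ (U.torsionProj n d x) (U.op d (U.torsionProj n d x)) := by
    rw [inner_torsionProj, torsionProj_op, torsionProj_idem]
  have h3 := abs_real_inner_le_norm (U.torsionProj n d x) (U.op d (U.torsionProj n d x))
  rw [U.norm_op, ← h2, ← sq] at h3
  rw [h1] at h0
  linarith [neg_abs_le (inner ℝ x (U.op d (U.torsionProj n d x)))]

/-- The ratio bound for an isometric representation: `x` plays the role of the indicator of an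
independent set, `e` that of the constant function `1`. -/
theorem ratio_bound (n m : ℕ) (d : ℕ → Γ)
    (hd : ∀ i j l, i < j → j < l → l < m → ∀ S : AddSubgroup Γ,
      n • d i ∈ S → n • d j ∈ S → n • d l ∈ S → d j ∈ S)
    {x e : H} {δ : ℝ} (he : ‖e‖ = 1) (hfix : ∀ v, U.op v e = e) (hxe : inner ℝ x e = δ)
    (hxx : ‖x‖ ^ 2 = δ)
    (horth : ∀ i < m, ∀ j : ℕ, inner ℝ x (U.op ((n * j + 1) • d i) x) = 0) :
    m * δ ^ 2 ≤ 2 * (δ - δ ^ 2) := by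
  have hzero (i j l : ℕ) (hij : i < j) (hjl : j < l) (hl : l < m) (y : H) :
      U.torsionProj n (d i) (U.torsionProj n (d j) (U.torsionProj n (d l) y)) = 0 := by
    set w := U.torsionProj n (d i) (U.torsionProj n (d j) (U.torsionProj n (d l) y)) with hw
    have hwj : w = U.torsionProj n (d j) (U.torsionProj n (d i) (U.torsionProj n (d l) y)) := by
      rw [hw, U.torsionProj_comm]
    have hwl : w = U.torsionProj n (d l) (U.torsionProj n (d i) (U.torsionProj n (d j) y)) := by
      rw [hw, U.torsionProj_comm n (d j) (d l), U.torsionProj_comm n (d i) (d l)]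
    have hi : n • d i ∈ U.stab w := U.op_torsionProj _ _ _
    have hj : n • d j ∈ U.stab w := by
      rw [mem_stab, hwj]
      exact U.op_torsionProj _ _ _
    have hl' : n • d l ∈ U.stab w := by
      rw [mem_stab, hwl]
      exact U.op_torsionProj _ _ _
    -- By `hd`, `w` is fixed by `d j`; but `w` lies in the range of the torsion projection of `d j`,
    -- which kills such vectors.
    have h1 := U.torsionProj_eq_zero_of_op_eq (n := n) (hd i j l hij hjl hl _ hi hj hl')
    rwa [hwj, torsionProj_idem, ← hwj] at h1
  have hsum := sum_norm_sq_le_of_triple_zero m (fun i => U.torsionProj n (d i))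
    (fun i => U.inner_torsionProj n (d i)) (fun i => U.torsionProj_idem n (d i))
    (fun i j => U.torsionProj_comm n (d i) (d j)) hzero (x - δ • e)
  have hnorm : ‖x - δ • e‖ ^ 2 = δ - δ ^ 2 := by
    rw [norm_sub_sq_real, inner_smul_right, hxe, hxx, norm_smul, he, mul_one, Real.norm_eq_abs,
      sq_abs]
    ring
  have hterm (i : ℕ) (hi : i ∈ Finset.range m) :
      δ ^ 2 ≤ ‖U.torsionProj n (d i) (x - δ • e)‖ ^ 2 := by
    have h1 := U.norm_fixedProj_le_norm_torsionProj (horth i (Finset.mem_range.1 hi))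
    -- Torsion projections kill `e`, so removing the constant part `δ • e` costs nothing here but
    -- lowers the total norm.
    rw [map_sub, map_smul, U.torsionProj_eq_zero_of_op_eq (hfix (d i)), smul_zero, sub_zero]
    refine le_trans ?_ h1
    have h2 : inner ℝ (fixedProj (U.op (d i)) x) e = δ := by
      rw [inner_fixedProj, fixedProj_of_apply_eq (hfix (d i)), hxe]
    have h3 := abs_real_inner_le_norm (fixedProj (U.op (d i)) x) e
    rw [h2, he, mul_one] at h3
    rw [← sq_abs]
    gcongr
  calc (m : ℝ) * δ ^ 2 = ∑ i ∈ Finset.range m, δ ^ 2 := by simp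
    _ ≤ _ := Finset.sum_le_sum hterm
    _ ≤ _ := hsum
    _ = _ := by rw [hnorm]

end IsometricRep

end HilbertSpace

/-! ### The Hilbert space of an invariant mean. -/

section InvariantMeans

open BoundedContinuousFunction UniformSpace

variable {Γ : Type*} [TopologicalSpace Γ] [DiscreteTopology Γ]

/-- The indicator function of a subset of a discrete group. -/
noncomputable def boundedIndicator (S : Set Γ) : Γ →ᵇ ℝ :=
  ofNormedAddCommGroupDiscrete (S.indicator 1) 1 fun x => by
    by_cases hx : x ∈ S <;> simp [hx]

@[simp]
theorem boundedIndicator_apply (S : Set Γ) (x : Γ) :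
    boundedIndicator S x = S.indicator (1 : Γ → ℝ) x := rfl

variable [AddCommGroup Γ]

/-- The translate `x ↦ f (x + v)` of a bounded function. -/
def shift (v : Γ) (f : Γ →ᵇ ℝ) : Γ →ᵇ ℝ :=
  f.compContinuous ⟨fun x => x + v, continuous_of_discreteTopology⟩

@[simp]
theorem shift_apply (v : Γ) (f : Γ →ᵇ ℝ) (x : Γ) : shift v f x = f (x + v) := rfl

/-- An invariant mean on the bounded functions on a discrete group. -/
structure InvariantMean (Γ : Type*) [AddCommGroup Γ] [TopologicalSpace Γ]
    [DiscreteTopology Γ] where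
  /-- The underlying linear functional. -/
  mean : (Γ →ᵇ ℝ) →ₗ[ℝ] ℝ
  mean_nonneg : ∀ f : Γ →ᵇ ℝ, (∀ x, 0 ≤ f x) → 0 ≤ mean f
  mean_one : mean 1 = 1
  mean_shift : ∀ v f, mean (shift v f) = mean f

namespace InvariantMean

set_option linter.unusedVariables false in
/-- The bounded functions with the semi-inner product given by an invariant mean. -/
@[nolint unusedArguments]
def PreL2 (M : InvariantMean Γ) : Type _ := Γ →ᵇ ℝ

variable (M : InvariantMean Γ)

noncomputable instance : AddCommGroup M.PreL2 := inferInstanceAs (AddCommGroup (Γ →ᵇ ℝ))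

noncomputable instance : Module ℝ M.PreL2 := inferInstanceAs (Module ℝ (Γ →ᵇ ℝ))

/-- A bounded function as a vector. -/
noncomputable def toPreL2 : (Γ →ᵇ ℝ) ≃ₗ[ℝ] M.PreL2 := LinearEquiv.refl ℝ _

/-- A vector as a bounded function. -/
noncomputable def ofPreL2 : M.PreL2 ≃ₗ[ℝ] (Γ →ᵇ ℝ) := M.toPreL2.symm

/-- The semi-inner product given by an invariant mean. -/
noncomputable abbrev preL2Core : PreInnerProductSpace.Core ℝ M.PreL2 where
  inner f g := M.mean (M.ofPreL2 f * M.ofPreL2 g)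
  conj_inner_symm f g := by simp [mul_comm]
  re_inner_nonneg f := M.mean_nonneg _ fun x => mul_self_nonneg _
  add_left f g h := by rw [map_add, add_mul, map_add]
  smul_left f g r := by simp [smul_mul_assoc]

noncomputable instance : SeminormedAddCommGroup M.PreL2 :=
  InnerProductSpace.Core.toSeminormedAddCommGroup (c := M.preL2Core)

noncomputable instance : InnerProductSpace ℝ M.PreL2 := InnerProductSpace.ofCore M.preL2Core

theorem inner_toPreL2 (f g : Γ →ᵇ ℝ) :
    inner ℝ (M.toPreL2 f) (M.toPreL2 g) = M.mean (f * g) := rfl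

/-- Translation as an isometry for the semi-inner product. -/
noncomputable def shiftₗᵢ (v : Γ) : M.PreL2 →ₗᵢ[ℝ] M.PreL2 :=
  LinearMap.isometryOfInner
    { toFun := fun f => M.toPreL2 (shift v (M.ofPreL2 f))
      map_add' := fun _ _ => rfl
      map_smul' := fun _ _ => rfl }
    fun f g => M.mean_shift v (M.ofPreL2 f * M.ofPreL2 g)

/-- The Hilbert space of an invariant mean. -/
abbrev L2 : Type _ := Completion M.PreL2

/-- The representation of the group on the Hilbert space of an invariant mean. -/
noncomputable def rep : IsometricRep Γ M.L2 where
  op v := (M.shiftₗᵢ v).toContinuousLinearMap.completion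
  op_zero x := by
    induction x using Completion.induction_on with
    | hp => exact isClosed_eq (ContinuousLinearMap.continuous _) continuous_id
    | ih f =>
      rw [ContinuousLinearMap.completion_apply_coe]
      congr 1
      exact BoundedContinuousFunction.ext fun x => congrArg (M.ofPreL2 f) (add_zero x)
  op_add v w x := by
    induction x using Completion.induction_on with
    | hp =>
      exact isClosed_eq (ContinuousLinearMap.continuous _)
        ((ContinuousLinearMap.continuous _).comp (ContinuousLinearMap.continuous _))
    | ih f =>
      simp only [ContinuousLinearMap.completion_apply_coe]
      congr 1
      exact BoundedContinuousFunction.ext fun x => congrArg (M.ofPreL2 f) (add_assoc x v w).symm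
  norm_op v x := by
    induction x using Completion.induction_on with
    | hp => exact isClosed_eq (ContinuousLinearMap.continuous _).norm continuous_norm
    | ih f =>
      rw [ContinuousLinearMap.completion_apply_coe, Completion.norm_coe, Completion.norm_coe]
      exact (M.shiftₗᵢ v).norm_map f

/-- A bounded function as a vector of the Hilbert space. -/
noncomputable def toL2 (f : Γ →ᵇ ℝ) : M.L2 := (M.toPreL2 f : Completion M.PreL2)

theorem inner_toL2 (f g : Γ →ᵇ ℝ) : inner ℝ (M.toL2 f) (M.toL2 g) = M.mean (f * g) := by
  rw [toL2, toL2, Completion.inner_coe, inner_toPreL2]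

theorem rep_op_toL2 (v : Γ) (f : Γ →ᵇ ℝ) : M.rep.op v (M.toL2 f) = M.toL2 (shift v f) :=
  ContinuousLinearMap.completion_apply_coe _ _

/-- The ratio bound for the invariant mean of a set that avoids the differences
`(n j + 1) d i`, `i < m`. -/
theorem ratio_bound (n m : ℕ) (d : ℕ → Γ)
    (hd : ∀ i j l, i < j → j < l → l < m → ∀ S : AddSubgroup Γ,
      n • d i ∈ S → n • d j ∈ S → n • d l ∈ S → d j ∈ S)
    {I : Set Γ} (hI : ∀ i < m, ∀ j : ℕ, ∀ x ∈ I, x + (n * j + 1) • d i ∉ I) :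
    m * M.mean (boundedIndicator I) ^ 2 ≤
      2 * (M.mean (boundedIndicator I) - M.mean (boundedIndicator I) ^ 2) := by
  have hsq : boundedIndicator I * boundedIndicator I = boundedIndicator I := by
    ext x
    by_cases hx : x ∈ I <;> simp [hx]
  refine M.rep.ratio_bound n m d hd (x := M.toL2 (boundedIndicator I)) (e := M.toL2 1)
    ?_ (fun v => ?_) ?_ ?_ fun i hi j => ?_
  · rw [← sq_eq_sq₀ (norm_nonneg _) zero_le_one, ← real_inner_self_eq_norm_sq, inner_toL2, mul_one,
      M.mean_one, one_pow]
  · rw [rep_op_toL2]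
    rfl
  · rw [inner_toL2, mul_one]
  · rw [← real_inner_self_eq_norm_sq, inner_toL2, hsq]
  · rw [rep_op_toL2, inner_toL2, ← map_zero M.mean]
    congr 1
    ext x
    by_cases hx : x ∈ I
    · simp [hI i hi j x hx]
    · simp [hx]

end InvariantMean

end InvariantMeans

/-! ### Arithmetic of the generators. -/

/-- For `i < j < l`, the middle one of three generators lies in every subgroup that contains the
`q`-fold multiples of all three. -/
theorem genVector_mem_of_smul_mem {p q k i j l : ℕ} (hcop : Nat.Coprime p q)
    (hij : i < j) (hjl : j < l) (hl : l < 2 * k) (S : AddSubgroup (Fin 2 → ℤ))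
    (hi : q • genVector p q k i ∈ S) (hj : q • genVector p q k j ∈ S)
    (hl' : q • genVector p q k l ∈ S) : genVector p q k j ∈ S := by
  obtain ⟨a, rfl⟩ : ∃ a, j = i + (a + 1) := ⟨j - i - 1, by omega⟩
  obtain ⟨b, rfl⟩ : ∃ b, l = i + (a + 1) + (b + 1) := ⟨l - (i + (a + 1)) - 1, by omega⟩
  obtain ⟨c, hc⟩ : ∃ c, 2 * k = i + (a + 1) + (b + 1) + (c + 1) :=
    ⟨2 * k - (i + (a + 1) + (b + 1)) - 1, by omega⟩
  have e1 : 2 * k - i = (a + 1) + (b + 1) + (c + 1) := by omega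
  have e2 : 2 * k - (i + (a + 1)) = (b + 1) + (c + 1) := by omega
  have e3 : 2 * k - (i + (a + 1) + (b + 1)) = c + 1 := by omega
  set A : ℤ := (q : ℤ) ^ a
  set B : ℤ := (q : ℤ) ^ b
  set G : ℤ := (q : ℤ) ^ c
  set s : ℤ := (q : ℤ) ^ i
  set Q : ℤ := (q : ℤ)
  set P : ℤ := (p : ℤ)
  set x : ℤ := Q * A
  set y : ℤ := Q * B
  set g : ℤ := Q * G
  -- `hrel` is Cramer's rule `det(d_i, d_l) d_j = det(d_j, d_l) d_i + det(d_i, d_j) d_l` divided by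
  -- `q^(2k) / (x y)`. The coefficients on the right keep factors `x = q A` and `y = q B`, while `u
  -- ≡ -p` modulo `q` is invertible.
  set u : ℤ := (x * y - 1) * (P * (1 + x * y) + 2 * (x * y * g) * (s * s * x * y + 1)) with hu
  have hrel : u • genVector p q k (i + (a + 1)) =
      (A * ((y - 1) * (P * (1 + y) + 2 * (y * g) * (s * x * (s * x * y) + 1)))) •
        (q • genVector p q k i) +
      (B * ((x - 1) * (P * (1 + x) + 2 * (x * y * g) * (s * (s * x) + 1)))) •
        (q • genVector p q k (i + (a + 1) + (b + 1))) := by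
    ext t
    fin_cases t
    · simp only [genVector, e1, e2, e3]
      simp [hc, pow_add]
      ring
    · simp only [genVector, e1, e2, e3]
      simp [hc, pow_add]
      ring
  have hmem : u • genVector p q k (i + (a + 1)) ∈ S := by
    rw [hrel]
    exact S.add_mem (S.zsmul_mem hi _) (S.zsmul_mem hl' _)
  have hcopu : IsCoprime u Q := by
    have h1 : IsCoprime (-P) Q := (Nat.isCoprime_iff_coprime.2 hcop).neg_left
    have h2 : u = -P + Q * (A * y * (P * (x * y)) +
        (x * y - 1) * (2 * (A * y * g) * (s * s * x * y + 1))) := by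
      simp only [hu, x]; ring
    rw [h2]
    exact IsCoprime.add_mul_left_left_iff.2 h1
  obtain ⟨α, β, hαβ⟩ := hcopu
  have h1 : genVector p q k (i + (a + 1)) =
      α • (u • genVector p q k (i + (a + 1))) + β • (q • genVector p q k (i + (a + 1))) := by
    rw [← natCast_zsmul, smul_smul, smul_smul, ← add_smul, hαβ, one_smul]
  rw [h1]
  exact S.add_mem (S.zsmul_mem hmem _) (S.zsmul_mem hj _)

/-! ### Box averages, invariant means and upper density. -/

section BoxMeans

open BoundedContinuousFunction Topology

/-- The lattice points of `[-n, n]²`. -/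
noncomputable def finBox (n : ℕ) : Finset (Fin 2 → ℤ) :=
  Finset.Icc (fun _ => -(n : ℤ)) (fun _ => (n : ℤ))

theorem mem_finBox {n : ℕ} {x : Fin 2 → ℤ} : x ∈ finBox n ↔ ∀ i, -(n : ℤ) ≤ x i ∧ x i ≤ n := by
  simp [finBox, Pi.le_def, forall_and]

theorem card_finBox (n : ℕ) : ((finBox n).card : ℝ) = (2 * n + 1) ^ 2 := by
  have h : ((n : ℤ) + 1 + n).toNat = 2 * n + 1 := by omega
  simp [finBox, Pi.card_Icc, h]

theorem mem_latticeBox_iff {R : ℝ} (hR : 0 ≤ R) (x : Fin 2 → ℤ) :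
    x ∈ latticeBox 2 R ↔ x ∈ finBox ⌊R⌋₊ := by
  have h : ((⌊R⌋₊ : ℕ) : ℤ) = ⌊R⌋ := Int.natCast_floor_eq_floor hR
  simp only [latticeBox, Set.mem_ofPred_eq, mem_finBox, Set.mem_Icc, h]
  refine forall_congr' fun i => and_congr ?_ Int.le_floor.symm
  rw [neg_le, neg_le (a := ⌊R⌋), Int.le_floor]
  push_cast
  rfl

/-- The average of a function over the lattice points of `[-n, n]²`. -/
noncomputable def boxMean (n : ℕ) (f : (Fin 2 → ℤ) →ᵇ ℝ) : ℝ :=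
  (∑ x ∈ finBox n, f x) / (2 * n + 1) ^ 2

theorem abs_sum_le_norm_mul_card (s : Finset (Fin 2 → ℤ)) (f : (Fin 2 → ℤ) →ᵇ ℝ) :
    |∑ x ∈ s, f x| ≤ ‖f‖ * s.card := by
  calc |∑ x ∈ s, f x| ≤ ∑ x ∈ s, |f x| := Finset.abs_sum_le_sum_abs _ _
    _ ≤ ∑ _x ∈ s, ‖f‖ := Finset.sum_le_sum fun x _ => f.norm_coe_le_norm x
    _ = ‖f‖ * s.card := by rw [Finset.sum_const, nsmul_eq_mul, mul_comm]

theorem boxMean_mem_Icc (n : ℕ) (f : (Fin 2 → ℤ) →ᵇ ℝ) : boxMean n f ∈ Set.Icc (-‖f‖) ‖f‖ := by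
  rw [Set.mem_Icc, ← abs_le, boxMean, abs_div,
    abs_of_pos (by positivity : (0 : ℝ) < (2 * n + 1) ^ 2), div_le_iff₀ (by positivity), ← card_finBox]
  exact abs_sum_le_norm_mul_card _ f

theorem abs_sum_shift_sub_le (f : (Fin 2 → ℤ) →ᵇ ℝ) (v : Fin 2 → ℤ) {n c : ℕ} (hc : c ≤ n)
    (hv : ∀ i, |v i| ≤ c) :
    |∑ x ∈ finBox n, shift v f x - ∑ x ∈ finBox n, f x| ≤ 2 * ‖f‖ * (4 * c * (2 * n + 1)) := by
  have hshift : ∑ x ∈ finBox n, shift v f x = ∑ x ∈ (finBox n).map (addRightEmbedding v), f x := by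
    rw [Finset.sum_map]
    rfl
  -- The box and its translate have equal size and both contain the box of radius `n - c`; each
  -- exceeds it by at most `4c(2n+1)` points.
  have key (s : Finset (Fin 2 → ℤ)) (hs : finBox (n - c) ⊆ s) (hcard : s.card = (finBox n).card) :
      |∑ x ∈ s, f x - ∑ x ∈ finBox (n - c), f x| ≤ ‖f‖ * (4 * c * (2 * n + 1)) := by
    rw [← Finset.sum_sdiff hs, add_sub_cancel_right]
    refine (abs_sum_le_norm_mul_card _ f).trans ?_
    gcongr
    rw [Finset.cast_card_sdiff hs, hcard, card_finBox, card_finBox, Nat.cast_sub hc]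
    nlinarith [sq_nonneg (c : ℝ)]
  have h1 := key (finBox n) (fun x hx => by
    rw [mem_finBox] at hx ⊢
    intro i
    have := hx i
    omega) rfl
  have h2 := key ((finBox n).map (addRightEmbedding v)) (fun x hx => by
    rw [mem_finBox] at hx
    rw [Finset.mem_map]
    refine ⟨x - v, mem_finBox.2 fun i => ?_, sub_add_cancel x v⟩
    have := hx i
    have := abs_le.1 (hv i)
    rw [Pi.sub_apply]
    omega) (Finset.card_map _)
  rw [hshift]
  have h3 := abs_sub_le (∑ x ∈ (finBox n).map (addRightEmbedding v), f x)
    (∑ x ∈ finBox (n - c), f x) (∑ x ∈ finBox n, f x)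
  rw [abs_sub_comm (∑ x ∈ finBox (n - c), f x)] at h3
  linarith

theorem tendsto_boxMean_shift_sub (f : (Fin 2 → ℤ) →ᵇ ℝ) (v : Fin 2 → ℤ) :
    Tendsto (fun n => boxMean n (shift v f) - boxMean n f) atTop (𝓝 0) := by
  obtain ⟨c, hv⟩ : ∃ c : ℕ, ∀ i, |v i| ≤ c := by
    refine ⟨∑ i, (v i).natAbs, fun i => ?_⟩
    rw [Int.abs_eq_natAbs, Int.ofNat_le]
    exact Finset.single_le_sum (f := fun i => (v i).natAbs) (fun _ _ => Nat.zero_le _)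
      (Finset.mem_univ i)
  have hlim : Tendsto (fun n : ℕ => 8 * ‖f‖ * c * (1 / ((n : ℝ) + 1))) atTop (𝓝 0) := by
    simpa using tendsto_one_div_add_atTop_nhds_zero_nat.const_mul (8 * ‖f‖ * c)
  refine squeeze_zero_norm' ?_ hlim
  filter_upwards [eventually_ge_atTop c] with n hn
  have h := abs_sum_shift_sub_le f v hn hv
  rw [boxMean, boxMean, ← sub_div, Real.norm_eq_abs, abs_div,
    abs_of_pos (by positivity : (0 : ℝ) < (2 * n + 1) ^ 2)]
  calc _ ≤ 2 * ‖f‖ * (4 * c * (2 * n + 1)) / (2 * n + 1) ^ 2 := by gcongr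
    _ = 8 * ‖f‖ * c * (1 / (2 * n + 1)) := by field_simp; ring
    _ ≤ 8 * ‖f‖ * c * (1 / (n + 1)) := by
      gcongr
      linarith [(Nat.cast_nonneg n : (0 : ℝ) ≤ n)]

/-- The averages over boxes converge to an invariant mean along every nonprincipal ultrafilter. -/
theorem exists_invariantMean_tendsto (u : Ultrafilter ℕ) (hu : (u : Filter ℕ) ≤ atTop) :
    ∃ M : InvariantMean (Fin 2 → ℤ), ∀ f, Tendsto (fun n => boxMean n f) u (𝓝 (M.mean f)) := by
  have hex (f : (Fin 2 → ℤ) →ᵇ ℝ) : ∃ a, Tendsto (fun n => boxMean n f) u (𝓝 a) := by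
    obtain ⟨a, -, ha⟩ := isCompact_Icc.ultrafilter_le_nhds (u.map fun n => boxMean n f)
      (le_principal_iff.2 (Filter.mem_map.2 (Eventually.of_forall fun n => boxMean_mem_Icc n f)))
    exact ⟨a, ha⟩
  choose L hL using hex
  refine ⟨⟨⟨⟨L, fun f g => ?_⟩, fun c f => ?_⟩, fun f hf => ?_, ?_, fun v f => ?_⟩, hL⟩
  · refine tendsto_nhds_unique (hL (f + g)) (((hL f).add (hL g)).congr fun n => ?_)
    simp [boxMean, Finset.sum_add_distrib, add_div]
  · refine tendsto_nhds_unique (hL (c • f)) (((hL f).const_mul c).congr fun n => ?_)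
    simp [boxMean, ← Finset.mul_sum, mul_div_assoc]
  · refine ge_of_tendsto (hL f) (Eventually.of_forall fun n => ?_)
    exact div_nonneg (Finset.sum_nonneg fun x _ => hf x) (by positivity)
  · refine tendsto_nhds_unique (hL 1) (tendsto_const_nhds.congr fun n => ?_)
    have h : ((2 : ℝ) * n + 1) ^ 2 ≠ 0 := by positivity
    simp [boxMean, card_finBox, h]
  · refine sub_eq_zero.1 (tendsto_nhds_unique ((hL (shift v f)).sub (hL f)) ?_)
    exact (tendsto_boxMean_shift_sub f v).mono_left hu

theorem ncard_inter_latticeBox (I : Set (Fin 2 → ℤ)) {R : ℝ} (hR : 0 ≤ R) :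
    ((I ∩ latticeBox 2 R).ncard : ℝ) = ∑ x ∈ finBox ⌊R⌋₊, boundedIndicator I x := by
  classical
  have h : I ∩ latticeBox 2 R = ((finBox ⌊R⌋₊).filter (· ∈ I) : Finset (Fin 2 → ℤ)) := by
    ext x
    simp [mem_latticeBox_iff hR, and_comm]
  rw [h, Set.ncard_coe_finset]
  simp [Set.indicator_apply]

/-- If all invariant means of a set are less than `C`, then so are its densities in large boxes. -/
theorem eventually_density_le {I : Set (Fin 2 → ℤ)} {C : ℝ}
    (hI : ∀ M : InvariantMean (Fin 2 → ℤ), M.mean (boundedIndicator I) < C) :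
    ∀ᶠ R : ℝ in atTop, ((I ∩ latticeBox 2 R).ncard / (2 * R) ^ 2 : ℝ) ≤ C := by
  -- The factor absorbs the passage from `(2n+1)²` to the smaller `(2n)² ≤ (2R)²`. If the bound
  -- failed for arbitrarily large `n`, an ultrafilter on the failures would give an invariant mean
  -- at least `C`.
  have hev : ∀ᶠ n : ℕ in atTop, boxMean n (boundedIndicator I) * (1 + 1 / (n : ℝ)) ^ 2 ≤ C := by
    by_contra hfreq
    rw [not_eventually, frequently_iff_neBot] at hfreq
    obtain ⟨u, hu⟩ := Ultrafilter.exists_le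
      (atTop ⊓ 𝓟 {n : ℕ | ¬ boxMean n (boundedIndicator I) * (1 + 1 / (n : ℝ)) ^ 2 ≤ C})
    obtain ⟨M, hM⟩ := exists_invariantMean_tendsto u (hu.trans inf_le_left)
    have h1 : Tendsto (fun n : ℕ => (1 + 1 / (n : ℝ)) ^ 2) u (𝓝 1) := by
      have h := ((tendsto_one_div_atTop_nhds_zero_nat (𝕜 := ℝ)).const_add 1).pow 2
      rw [add_zero, one_pow] at h
      exact h.mono_left (hu.trans inf_le_left)
    have h2 := (hM (boundedIndicator I)).mul h1
    rw [mul_one] at h2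
    refine (hI M).not_ge (ge_of_tendsto h2 ?_)
    have h3 : ∀ᶠ n in (u : Filter ℕ),
        n ∈ {n : ℕ | ¬ boxMean n (boundedIndicator I) * (1 + 1 / (n : ℝ)) ^ 2 ≤ C} :=
      (hu.trans inf_le_right) (mem_principal_self _)
    filter_upwards [h3] with n hn
    exact (not_le.1 hn).le
  filter_upwards [(tendsto_nat_floor_atTop (α := ℝ)).eventually hev, eventually_ge_atTop 1]
    with R hR hR1
  refine le_trans ?_ hR
  have hR0 : 0 ≤ R := zero_le_one.trans hR1
  set n := ⌊R⌋₊ with hn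
  have hn1 : (1 : ℝ) ≤ n := by
    have : 1 ≤ n := Nat.le_floor (by simpa using hR1)
    exact_mod_cast this
  have hnR : (n : ℝ) ≤ R := Nat.floor_le hR0
  rw [ncard_inter_latticeBox I hR0, ← hn, boxMean]
  set S := ∑ x ∈ finBox n, boundedIndicator I x with hS
  have hS0 : 0 ≤ S := Finset.sum_nonneg fun x _ => Set.indicator_nonneg (fun _ _ => zero_le_one) x
  calc S / (2 * R) ^ 2 ≤ S / (2 * n) ^ 2 := by gcongr
    _ = S / (2 * n + 1) ^ 2 * (1 + 1 / (2 * n)) ^ 2 := by field_simp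
    _ ≤ S / (2 * n + 1) ^ 2 * (1 + 1 / n) ^ 2 := by
      gcongr
      linarith

end BoxMeans

/-! ### The density and chromatic bounds. -/

theorem mean_boundedIndicator_le {p q k : ℕ} (hq : 0 < q) (hcop : Nat.Coprime p q)
    (M : InvariantMean (Fin 2 → ℤ)) {I : Set (Fin 2 → ℤ)} (hI : (graphC p q k).IsIndepSet I) :
    M.mean (boundedIndicator I) ≤ 1 / ((k : ℝ) + 1) := by
  have h := M.ratio_bound q (2 * k) (genVector p q k)
    (fun i j l hij hjl hl S => genVector_mem_of_smul_mem hcop hij hjl hl S) (I := I)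
    fun i hi j x hx hy => by
      have hadj : (graphC p q k).Adj (x + (q * j + 1) • genVector p q k i) x := by
        rw [graphC_adj hq, add_sub_cancel_left]
        refine Set.mem_iUnion.2 ⟨j, genVector p q k i, ⟨i, hi, Or.inl rfl⟩, ?_⟩
        rw [← natCast_zsmul]
        push_cast
        rfl
      exact hI hy hx hadj.ne hadj
  set δ := M.mean (boundedIndicator I)
  push_cast at h
  rw [le_div_iff₀ (by positivity)]
  by_contra! hlt
  -- Positivity allows `h`, which says `k δ² ≤ δ - δ²`, to be divided by `δ`.
  have hδ : 0 < δ := by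
    by_contra! h0
    nlinarith [(Nat.cast_nonneg k : (0 : ℝ) ≤ k)]
  nlinarith

theorem theorem8 (p q k : ℕ) (hp : 0 < p) (hpq : p < q) (hcop : Nat.Coprime p q) (hk : 0 < k) :
    independenceDensity (graphC p q k) ≤ ((1 / ((k : ℝ) + 1) : ℝ) : EReal) ∧
      ((k + 1 : ℕ) : ℕ∞) ≤ (graphC p q k).chromaticNumber := by
  have hq : 0 < q := hp.trans hpq
  constructor
  · refine iSup₂_le fun I hI => le_of_forall_gt_imp_ge_of_dense fun c hc => ?_
    obtain ⟨C, hC, hCc⟩ := EReal.lt_iff_exists_real_btwn.1 hc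
    refine le_trans ?_ hCc.le
    refine limsup_le_of_le (by isBoundedDefault) ?_
    filter_upwards [eventually_density_le (I := I) (C := C) fun M =>
      (mean_boundedIndicator_le hq hcop M hI).trans_lt (EReal.coe_lt_coe_iff.1 hC)] with R hR
    exact EReal.coe_le_coe_iff.2 hR
  · by_contra! hlt
    have hle : (graphC p q k).chromaticNumber ≤ (k : ℕ∞) := by
      push_cast at hlt
      exact Order.le_of_lt_add_one hlt
    obtain ⟨c⟩ := SimpleGraph.chromaticNumber_le_iff_colorable.1 hle
    obtain ⟨M, -⟩ := exists_invariantMean_tendsto _ (Ultrafilter.of_le atTop)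
    have hindep (a : Fin k) : (graphC p q k).IsIndepSet {x | c x = a} :=
      fun x hx y hy _ hadj => c.valid hadj (hx.trans hy.symm)
    have hsum : ∑ a : Fin k, boundedIndicator {x | c x = a} = 1 := by
      ext x
      rw [BoundedContinuousFunction.sum_apply]
      simp [Set.indicator_apply]
    -- With only `k` colours the total mean would be at most `k/(k+1) < 1`.
    have h1 : M.mean 1 ≤ ∑ _a : Fin k, 1 / ((k : ℝ) + 1) := by
      rw [← hsum, map_sum]
      exact Finset.sum_le_sum fun a _ => mean_boundedIndicator_le hq hcop M (hindep a)
    rw [M.mean_one, Finset.sum_const, Finset.card_univ, Fintype.card_fin, nsmul_eq_mul, mul_one_div,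
      le_div_iff₀ (by positivity)] at h1
    linarith
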